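/- All graphs are finite and simple. Let $\mathcal P$ be a hereditary property of graphs, that is, a family of graphs closed under isomorphism and under taking induced subgraphs, and suppose that $\mathcal P$ is non-trivial, i.e. it contains all edgeless graphs and misses some graph. Let $k = k(\mathcal P) \ge 2$ be the minimum chromatic number of a graph that does not belong to $\mathcal P$. For a graph $G$, let $\mathrm{ex}(G,\mathcal P)$ be the maximum number of edges of a (not necessarily induced or spanning) subgraph of $G$ that belongs to $\mathcal P$, and let $e(G)$ be the number of edges of $G$. Then for every $\varepsilon > 0$ there exists a graph $H$ such that $$\mathrm{ex}(H,\mathcal P) < \left(1 - \frac{1}{k-1} + \varepsilon\right) e(H).$$ -/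

import Mathlib

/-- A property of (finite, simple) graphs. Only its values on graphs with a finite vertex set are
ever used. -/
abbrev GraphProperty : Type 1 := ∀ V : Type, SimpleGraph V → Prop

namespace GraphProperty

/-- A property of finite graphs is hereditary if it is invariant under isomorphism and closed under
taking induced subgraphs. -/
structure IsHereditary (P : GraphProperty) : Prop where
  iso : ∀ (V W : Type) [Finite V] [Finite W] (G : SimpleGraph V) (H : SimpleGraph W),
    Nonempty (G ≃g H) → P V G → P W H
  induce : ∀ (V : Type) [Finite V] (G : SimpleGraph V) (s : Set V), P V G → P s (G.induce s)

/-- A property of finite graphs is non-trivial if it contains all edgeless graphs and misses some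
graph. -/
structure IsNontrivial (P : GraphProperty) : Prop where
  edgeless : ∀ (V : Type) [Finite V], P V (⊥ : SimpleGraph V)
  misses : ∃ (V : Type) (_ : Finite V) (G : SimpleGraph V), ¬ P V G

/-- The chromatic numbers of the finite graphs that do not belong to `P`. -/
def missedChromaticNumbers (P : GraphProperty) : Set ℕ :=
  {c | ∃ (V : Type) (_ : Finite V) (L : SimpleGraph V), ¬ P V L ∧ L.chromaticNumber = (c : ℕ∞)}

/-- `k(P)`: the minimum chromatic number of a finite graph that does not belong to `P`. -/
noncomputable def minChromaticNumber (P : GraphProperty) : ℕ :=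
  sInf P.missedChromaticNumbers

/-- The numbers of edges of the (not necessarily induced, not necessarily spanning) subgraphs of
`G` that belong to `P`. -/
def subgraphEdgeCounts {V : Type} (G : SimpleGraph V) (P : GraphProperty) : Set ℕ :=
  {m | ∃ S : G.Subgraph, P S.verts S.coe ∧ S.edgeSet.ncard = m}

/-- `ex(G, P)`: the maximum number of edges of a subgraph of `G` that belongs to `P`. -/
noncomputable def ex {V : Type} (G : SimpleGraph V) (P : GraphProperty) : ℕ :=
  sSup (subgraphEdgeCounts G P)

/-- For a non-trivial property the minimum defining `k(P)` is attained. -/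
theorem IsNontrivial.isLeast_minChromaticNumber {P : GraphProperty} (h : P.IsNontrivial) :
    IsLeast P.missedChromaticNumbers P.minChromaticNumber := by
  have hne : P.missedChromaticNumbers.Nonempty := by
    obtain ⟨V, hV, G, hG⟩ := h.misses
    have := Fintype.ofFinite V
    have hc : G.chromaticNumber ≠ ⊤ :=
      SimpleGraph.chromaticNumber_ne_top_iff_exists.2 ⟨_, G.colorable_of_fintype⟩
    exact ⟨G.chromaticNumber.toNat, V, hV, G, hG, (ENat.natCast_toNat hc).symm⟩
  exact ⟨Nat.sInf_mem hne, fun _ hc => Nat.sInf_le hc⟩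

/-- For a non-trivial property, `k(P) ≥ 2`. -/
theorem IsNontrivial.two_le_minChromaticNumber {P : GraphProperty} (h : P.IsNontrivial) :
    2 ≤ P.minChromaticNumber := by
  obtain ⟨V, hV, L, hL, hc⟩ := h.isLeast_minChromaticNumber.1
  have hne : L ≠ ⊥ := by
    rintro rfl
    exact hL (h.edgeless V)
  exact_mod_cast hc ▸ SimpleGraph.two_le_chromaticNumber_iff_ne_bot.2 hne

/-- For a non-trivial property and a finite graph the maximum defining `ex(G, P)` is attained. -/
theorem IsNontrivial.isGreatest_ex {P : GraphProperty} (h : P.IsNontrivial) {V : Type} [Finite V]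
    (G : SimpleGraph V) : IsGreatest (subgraphEdgeCounts G P) (ex G P) := by
  have hne : (subgraphEdgeCounts G P).Nonempty := by
    refine ⟨_, ⊥, ?_, rfl⟩
    have hb : (⊥ : G.Subgraph).coe = ⊥ := by
      ext a b
      simp
    rw [hb]
    exact h.edgeless _
  have hbd : BddAbove (subgraphEdgeCounts G P) := by
    refine ⟨G.edgeSet.ncard, ?_⟩
    rintro m ⟨S, -, rfl⟩
    exact Set.ncard_le_ncard S.edgeSet_subset (Set.toFinite _)
  exact ⟨Nat.sSup_mem hne hbd, fun _ hm => le_csSup hbd hm⟩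

end GraphProperty

/-!
Let `k = r + 1` be the minimum chromatic number of a graph outside `P`, attained by `L`. It is
enough to find `H` such that every subgraph `S` with at least a `1 - 1 / r + ε` proportion of the
edges of `H` contains a copy of `L` that is induced in `H`: such a copy is also induced in `S`, so
`S` is not in `P`. No regularity lemma is needed for this.

Take for `H` the graph of the entries `-1` of a large Sylvester–Hadamard matrix. By Lindsey's lemma
its adjacency function, and that of its complement, differ from the constant `1 / 2` by a function
of small cut norm (`exists_quasirandom`). Hence, in the average over all maps `x` from a fixed
finite set to `V(H)` of a product of factors `g (x i) (x j)`, any factor that is the indicator of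
`H` or of its complement can be replaced by `1 / 2` at a small cost, if the others are at most `1`
(`counting_lemma`). This is used twice.

* Averaging the number of edges of `S` over the `m`-cliques of `H`, replacing all factors but the
  one that indicates an edge of `S`, shows that a positive proportion of these cliques carry more
  than a `1 - 1 / r + ε / 2` proportion of edges of `S`. By Turán's theorem such a clique contains
  a `k`-clique of `S`, so `S` has positive `k`-clique density (`exists_clique_density`). Blowing up
  by Jensen's inequality (`pow_expect_le_expect_blowup`), the homomorphism density of the
  `k`-colourable graph `L` in `S` is bounded below by a positive constant.
* Requiring in addition that the non-edges of `L` go to edges of the complement of `H` multiplies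
  this density by a power of `1 / 2`, up to a small error; so some map does this, and it is an
  embedding (`exists_forall_dense_subgraph_exists_induced`).

The vertex set of a subgraph may omit vertices of `H`, so isolated vertices of `L` could be
mapped outside `S`; this is avoided by attaching a pendant edge to each vertex of `L` (`corona`).
-/

open Finset Function
open scoped BigOperators

/-! ### Averages over assignments -/

/-- Composing a uniformly random assignment with an injection gives a uniformly random
assignment. -/
theorem expect_comp_injective {ι κ V : Type*} [Fintype ι] [DecidableEq ι] [Fintype κ]
    [DecidableEq κ] [Fintype V] [Nonempty V] {φ : κ → ι} (hφ : Injective φ) (F : (κ → V) → ℝ) :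
    𝔼 x : ι → V, F (x ∘ φ) = 𝔼 y, F y := by
  -- Exchanging `x ∘ φ` with an independent assignment `y` is an involution on the pairs.
  let e : (ι → V) × (κ → V) → (ι → V) × (κ → V) := fun p => (extend φ p.2 p.1, p.1 ∘ φ)
  have he : Involutive e := by
    rintro ⟨x, y⟩
    refine Prod.ext (funext fun i => ?_) (funext fun j => by simp [e, hφ.extend_apply])
    by_cases hi : ∃ j, φ j = i
    · obtain ⟨j, rfl⟩ := hi
      simp [e, hφ.extend_apply]
    · simp [e, extend_apply' _ _ _ hi]
  have h : 𝔼 p : (ι → V) × (κ → V), F (p.1 ∘ φ) = 𝔼 p : (ι → V) × (κ → V), F p.2 :=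
    Fintype.expect_equiv he.toPerm _ _ fun p => rfl
  rw [← univ_product_univ, expect_product, expect_product] at h
  simpa using h

/-- Resampling one coordinate of a uniformly random assignment does not change its
distribution. -/
theorem expect_update {ι V : Type*} [Fintype ι] [DecidableEq ι] [Fintype V] [Nonempty V] (u : ι)
    (F : (ι → V) → ℝ) : 𝔼 x : ι → V, 𝔼 a, F (update x u a) = 𝔼 x, F x := by
  let e : (ι → V) × V → (ι → V) × V := fun p => (update p.1 u p.2, p.1 u)
  have he : Involutive e := fun p => by simp [e]
  have h : 𝔼 p : (ι → V) × V, F (update p.1 u p.2) = 𝔼 p : (ι → V) × V, F p.1 :=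
    Fintype.expect_equiv he.toPerm _ _ fun p => rfl
  rw [← univ_product_univ, expect_product, expect_product] at h
  simpa using h

theorem expect_pair {ι V : Type*} [Fintype ι] [DecidableEq ι] [Fintype V] [Nonempty V] {u v : ι}
    (huv : u ≠ v) (f : V → V → ℝ) : 𝔼 x : ι → V, f (x u) (x v) = 𝔼 a, 𝔼 b, f a b := by
  rw [← expect_update v, ← expect_update u]
  simp [update_of_ne huv]

/-- Jensen's inequality for powers. -/
theorem pow_expect_le_expect_pow {α : Type*} [Fintype α] [Nonempty α] {f : α → ℝ}
    (hf : ∀ a, 0 ≤ f a) (n : ℕ) : (𝔼 a, f a) ^ n ≤ 𝔼 a, f a ^ n := by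
  have h := Real.pow_arith_mean_le_arith_mean_pow univ (fun _ : α => (Fintype.card α : ℝ)⁻¹) f
    (fun _ _ => by positivity) (by simp) (fun a _ => hf a) n
  rw [← mul_sum, ← mul_sum, ← div_eq_inv_mul, ← div_eq_inv_mul] at h
  rwa [← Fintype.expect_eq_sum_div_card, ← Fintype.expect_eq_sum_div_card] at h

/-! ### The counting lemma -/

/-- `f` has (normalised) cut norm at most `δ`, tested against weights in `[-1, 1]`. -/
def CutNormLE {V : Type*} [Fintype V] (f : V → V → ℝ) (δ : ℝ) : Prop :=
  ∀ α β : V → ℝ, (∀ a, |α a| ≤ 1) → (∀ b, |β b| ≤ 1) → |𝔼 a, 𝔼 b, f a b * α a * β b| ≤ δ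

/-- The cut norm controls averages in which the other factors each depend on at most one of the two
coordinates fed to `f`: freeze all the other coordinates. -/
theorem CutNormLE.expect_pair {ι V : Type*} [Fintype ι] [DecidableEq ι] [Fintype V] [Nonempty V]
    {f : V → V → ℝ} {δ : ℝ} (hf : CutNormLE f δ) {u v : ι} (huv : u ≠ v) {A B : (ι → V) → ℝ}
    (hA : ∀ x, |A x| ≤ 1) (hB : ∀ x, |B x| ≤ 1) (hAv : ∀ x b, A (update x v b) = A x)
    (hBu : ∀ x a, B (update x u a) = B x) :
    |𝔼 x : ι → V, f (x u) (x v) * A x * B x| ≤ δ := by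
  rw [← expect_update v, ← expect_update u]
  refine (abs_expect_le _ _).trans (expect_le univ_nonempty fun x _ => ?_)
  refine le_trans (le_of_eq ?_) (hf (fun a => A (update x u a)) (fun b => B (update x v b))
    (fun a => hA _) (fun b => hB _))
  congr 1
  refine expect_congr rfl fun a _ => expect_congr rfl fun b _ => ?_
  rw [hAv, update_comm huv, hBu]
  simp [update_of_ne huv.symm]

/-- Replacing the factors of a product of functions of pairs of coordinates, one factor at a
time, costs at most the cut norm of the difference for each factor. -/
theorem counting_lemma {ι V : Type*} [Fintype ι] [DecidableEq ι] [Fintype V] [Nonempty V]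
    {T : Finset (ι × ι)} (hT : ∀ p ∈ T, p.1 ≠ p.2 ∧ p.swap ∉ T) {g g' : ι × ι → V → V → ℝ} {δ : ℝ}
    (hg : ∀ p a b, |g p a b| ≤ 1) (hg' : ∀ p a b, |g' p a b| ≤ 1)
    (hd : ∀ p ∈ T, CutNormLE (fun a b => g p a b - g' p a b) δ) :
    |𝔼 x : ι → V, ∏ p ∈ T, g p (x p.1) (x p.2) - 𝔼 x : ι → V, ∏ p ∈ T, g' p (x p.1) (x p.2)| ≤
      #T * δ := by
  suffices h : ∀ T' ⊆ T, |𝔼 x : ι → V, ∏ p ∈ T, (if p ∈ T' then g p else g' p) (x p.1) (x p.2) -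
      𝔼 x : ι → V, ∏ p ∈ T, g' p (x p.1) (x p.2)| ≤ #T' * δ by
    refine le_trans (le_of_eq ?_) (h T Subset.rfl)
    congr 2
    exact expect_congr rfl fun x _ => prod_congr rfl fun p hp => by rw [if_pos hp]
  intro T'
  induction T' using Finset.induction_on with
  | empty => simp
  | insert q T' hq ih =>
    intro hsub
    obtain ⟨hqT, hT'⟩ := insert_subset_iff.1 hsub
    rw [card_insert_of_notMem hq]
    push_cast
    rw [add_mul, one_mul, add_comm]
    refine (abs_sub_le _ (𝔼 x : ι → V, ∏ p ∈ T, (if p ∈ T' then g p else g' p) (x p.1) (x p.2))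
      _).trans (add_le_add ?_ (ih hT'))
    rw [← expect_sub_distrib]
    set w : ι × ι → V → V → ℝ := fun p => if p ∈ T' then g p else g' p with hw
    have hw1 : ∀ p a b, |w p a b| ≤ 1 := fun p a b => by
      by_cases hp : p ∈ T' <;> simp [hw, hp, hg, hg']
    have hprod : ∀ (R : Finset (ι × ι)) (x : ι → V), |∏ p ∈ R, w p (x p.1) (x p.2)| ≤ 1 := by
      intro R x
      rw [abs_prod]
      exact prod_le_one (fun _ _ => abs_nonneg _) fun _ _ => hw1 _ _ _
    -- Of the remaining factors, those in `R₁` avoid the second coordinate of `q`; those in `R₂` involve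
    -- it, and hence avoid the first one.
    set R := T.erase q
    set R₁ := R.filter fun p => p.1 ≠ q.2 ∧ p.2 ≠ q.2
    set R₂ := R.filter fun p => ¬ (p.1 ≠ q.2 ∧ p.2 ≠ q.2)
    have hR₂ : ∀ p ∈ R₂, p.1 ≠ q.1 ∧ p.2 ≠ q.1 := by
      intro p hp
      obtain ⟨hpR, hp2⟩ := mem_filter.1 hp
      obtain ⟨hpq, hpT⟩ := mem_erase.1 hpR
      have h1 := hT p hpT
      have h2 := hT q hqT
      obtain ⟨p1, p2⟩ := p
      obtain ⟨q1, q2⟩ := q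
      simp only [Prod.swap_prod_mk, ne_eq, Prod.mk.injEq] at *
      refine ⟨?_, ?_⟩
      · rintro rfl
        have : p2 = q2 := by tauto
        exact hpq ⟨rfl, this⟩
      · rintro rfl
        have : p1 = q2 := by tauto
        subst this
        exact h2.2 hpT
    refine le_trans (le_of_eq ?_) ((hd q hqT).expect_pair (hT q hqT).1
      (A := fun x => ∏ p ∈ R₁, w p (x p.1) (x p.2)) (B := fun x => ∏ p ∈ R₂, w p (x p.1) (x p.2))
      (hprod _) (hprod _) ?_ ?_)
    · congr 1
      refine expect_congr rfl fun x _ => ?_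
      rw [mul_assoc, prod_filter_mul_prod_filter_not, ← mul_prod_erase T _ hqT,
        ← mul_prod_erase T _ hqT, sub_mul]
      have e1 : ∏ p ∈ T.erase q, (if p ∈ insert q T' then g p else g' p) (x p.1) (x p.2) =
          ∏ p ∈ R, w p (x p.1) (x p.2) :=
        prod_congr rfl fun p hp => by simp [hw, mem_insert, (mem_erase.1 hp).1]
      rw [e1]
      simp [hq, R, hw]
    · intro x b
      refine prod_congr rfl fun p hp => ?_
      obtain ⟨h1, h2⟩ := (mem_filter.1 hp).2
      rw [update_of_ne h1, update_of_ne h2]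
    · intro x a
      refine prod_congr rfl fun p hp => ?_
      obtain ⟨h1, h2⟩ := hR₂ p hp
      rw [update_of_ne h1, update_of_ne h2]

/-! ### Blowing up cliques -/

/-- If a `k`-variable function has mean `c`, then the mean over `t`-fold blow-ups, of the product
over all transversals, is at least `c ^ t ^ k`; this is Jensen's inequality applied in one
variable after another. -/
theorem pow_expect_le_expect_blowup {V : Type*} [Fintype V] [Nonempty V] (t k : ℕ)
    (F : (Fin k → V) → ℝ) (hF : ∀ y, 0 ≤ F y) :
    (𝔼 y, F y) ^ t ^ k ≤
      𝔼 x : Fin k → Fin t → V, ∏ σ : Fin k → Fin t, F fun i => x i (σ i) := by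
  induction k with
  | zero => simp [Subsingleton.elim _ (default : Fin 0 → V)]
  | succ k ih =>
    have hsplit : ∀ {X : Type _} [Fintype X] (G : (Fin (k + 1) → X) → ℝ),
        𝔼 y, G y = 𝔼 a, 𝔼 y, G (Fin.cons a y) := by
      intro X _ G
      rw [← expect_product', univ_product_univ]
      exact (Fintype.expect_equiv (Fin.consEquiv fun _ => X) _ _ fun p => rfl).symm
    set G : (Fin t → V) → (Fin k → V) → ℝ := fun z y => ∏ s, F (Fin.cons (z s) y)
    have hG : ∀ z y, 0 ≤ G z y := fun z y => prod_nonneg fun _ _ => hF _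
    have h1 : (𝔼 y, F y) ^ t ≤ 𝔼 z, 𝔼 y, G z y := by
      rw [hsplit F, expect_comm, expect_comm univ univ G]
      refine (pow_expect_le_expect_pow (fun y => expect_nonneg fun a _ => hF _) t).trans
        (le_of_eq (expect_congr rfl fun y _ => ?_))
      rw [expect_pow, Fintype.piFinset_univ]
    calc (𝔼 y, F y) ^ t ^ (k + 1) = ((𝔼 y, F y) ^ t) ^ t ^ k := by rw [← pow_mul, pow_succ']
      _ ≤ (𝔼 z, 𝔼 y, G z y) ^ t ^ k :=
        pow_le_pow_left₀ (pow_nonneg (expect_nonneg fun _ _ => hF _) _) h1 _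
      _ ≤ 𝔼 z, (𝔼 y, G z y) ^ t ^ k :=
        pow_expect_le_expect_pow (fun z => expect_nonneg fun _ _ => hG _ _) _
      _ ≤ 𝔼 z, 𝔼 x : Fin k → Fin t → V, ∏ σ : Fin k → Fin t, G z fun i => x i (σ i) :=
        expect_le_expect fun z _ => ih (G z) (hG z)
      _ = _ := by
        rw [hsplit]
        refine expect_congr rfl fun z _ => expect_congr rfl fun x _ => ?_
        calc ∏ σ : Fin k → Fin t, ∏ s, F (Fin.cons (z s) fun i => x i (σ i))
            = ∏ p : Fin t × (Fin k → Fin t), F (Fin.cons (z p.1) fun i => x i (p.2 i)) := by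
              rw [prod_comm, Fintype.prod_prod_type]
          _ = _ := Fintype.prod_equiv (Fin.consEquiv fun _ => Fin t) _ _ fun p => by
              refine congrArg F (funext fun i => ?_)
              refine Fin.cases ?_ (fun j => ?_) i <;> simp [Fin.consEquiv]

theorem CutNormLE.mono {V : Type*} [Fintype V] {f : V → V → ℝ} {δ δ' : ℝ} (hf : CutNormLE f δ)
    (h : δ ≤ δ') : CutNormLE f δ' :=
  fun α β hα hβ => (hf α β hα hβ).trans h

/-! ### A quasirandom graph -/

/-- The Sylvester–Hadamard matrix of order `2 ^ d`: its entries are `(-1) ^ ⟨a, b⟩`. -/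
def sylvester (d : ℕ) (a b : Fin d → Bool) : ℝ := ∏ i, if a i && b i then -1 else 1

theorem sylvester_comm (d : ℕ) (a b : Fin d → Bool) : sylvester d a b = sylvester d b a := by
  simp only [sylvester, Bool.and_comm]

theorem sylvester_eq_or (d : ℕ) (a b : Fin d → Bool) :
    sylvester d a b = 1 ∨ sylvester d a b = -1 := by
  unfold sylvester
  refine prod_induction _ (fun r : ℝ => r = 1 ∨ r = -1) ?_ (Or.inl rfl) fun i _ => ?_
  · rintro _ _ (rfl | rfl) (rfl | rfl) <;> simp
  · split_ifs <;> simp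

/-- Distinct columns of the Sylvester–Hadamard matrix are orthogonal. -/
theorem sum_sylvester_mul_sylvester (d : ℕ) (b b' : Fin d → Bool) :
    ∑ a, sylvester d a b * sylvester d a b' = if b = b' then 2 ^ d else 0 := by
  simp only [sylvester, ← prod_mul_distrib]
  rw [← Fintype.piFinset_univ, ← prod_univ_sum (fun _ : Fin d => (univ : Finset Bool))
    fun i c => (if c && b i then (-1 : ℝ) else 1) * if c && b' i then -1 else 1]
  split_ifs with h
  · subst h
    rw [prod_congr rfl fun i _ => show _ = (2 : ℝ) by cases b i <;> norm_num]
    simp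
  · obtain ⟨i, hi⟩ := Function.ne_iff.1 h
    refine prod_eq_zero (mem_univ i) ?_
    cases hb : b i <;> cases hb' : b' i <;> simp_all

/-- Lindsey's lemma for the Sylvester–Hadamard matrix. -/
theorem cutNormLE_sylvester {d : ℕ} {δ : ℝ} (hδ : 0 ≤ δ) (hd : 1 / 2 ^ d ≤ δ ^ 2) :
    CutNormLE (sylvester d) δ := by
  intro α β hα hβ
  set N : ℝ := 2 ^ d with hN
  have hN0 : 0 < N := by positivity
  have hcard : (Fintype.card (Fin d → Bool) : ℝ) = N := by simp [hN]
  have hsq : ∀ {f : (Fin d → Bool) → ℝ}, (∀ a, |f a| ≤ 1) → ∑ a, f a ^ 2 ≤ N := by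
    intro f hf
    rw [← hcard, ← card_univ, ← nsmul_one, ← sum_const]
    exact sum_le_sum fun a _ => (sq_le_one_iff_abs_le_one _).2 (hf a)
  have hsum : 𝔼 a, 𝔼 b, sylvester d a b * α a * β b =
      (∑ a, α a * ∑ b, sylvester d a b * β b) / N ^ 2 := by
    simp only [Fintype.expect_eq_sum_div_card, hcard, ← sum_div, div_div, sq, mul_sum]
    congr 1
    exact sum_congr rfl fun a _ => sum_congr rfl fun b _ => by ring
  have hcol : ∑ a, (∑ b, sylvester d a b * β b) ^ 2 = N * ∑ b, β b ^ 2 := by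
    calc ∑ a, (∑ b, sylvester d a b * β b) ^ 2
        = ∑ a, ∑ b, ∑ b', β b * β b' * (sylvester d a b * sylvester d a b') := by
          refine sum_congr rfl fun a _ => ?_
          rw [sq, sum_mul_sum]
          exact sum_congr rfl fun b _ => sum_congr rfl fun b' _ => by ring
      _ = ∑ b, ∑ b', β b * β b' * ∑ a, sylvester d a b * sylvester d a b' := by
          rw [sum_comm]
          refine sum_congr rfl fun b _ => ?_
          rw [sum_comm]
          simp only [mul_sum]
      _ = N * ∑ b, β b ^ 2 := by
          simp only [sum_sylvester_mul_sylvester, mul_ite, mul_zero, sum_ite_eq, mem_univ, if_true,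
            mul_sum]
          exact sum_congr rfl fun b _ => by ring
  have hcs : (∑ a, α a * ∑ b, sylvester d a b * β b) ^ 2 ≤ N * (N * N) := by
    refine (sum_mul_sq_le_sq_mul_sq _ _ _).trans ?_
    rw [hcol]
    exact mul_le_mul (hsq hα) (mul_le_mul_of_nonneg_left (hsq hβ) hN0.le) (by positivity) hN0.le
  rw [hsum]
  refine abs_le_of_sq_le_sq ?_ hδ
  refine le_trans ?_ hd
  rw [div_pow, div_le_div_iff₀ (by positivity) hN0]
  calc _ ≤ N * (N * N) * N := mul_le_mul_of_nonneg_right hcs hN0.le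
    _ = _ := by ring

/-- A function that agrees off the diagonal with a small multiple of the Sylvester–Hadamard matrix
has small cut norm, since the diagonal has density `1 / 2 ^ d`. -/
theorem CutNormLE.of_sylvester {d : ℕ} {δ c : ℝ} (hδ : 0 ≤ δ) (hd : 1 / 2 ^ d ≤ δ ^ 2)
    (hd' : 1 / 2 ^ d ≤ δ / 2) (hc : |c| ≤ 1 / 2) {f : (Fin d → Bool) → (Fin d → Bool) → ℝ}
    (hdiag : ∀ a, |f a a - c * sylvester d a a| ≤ 1)
    (hoff : ∀ a b, a ≠ b → f a b = c * sylvester d a b) : CutNormLE f δ := by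
  intro α β hα hβ
  have hsplit : 𝔼 a, 𝔼 b, f a b * α a * β b = c * 𝔼 a, 𝔼 b, sylvester d a b * α a * β b +
      𝔼 a, 𝔼 b, (f a b - c * sylvester d a b) * α a * β b := by
    simp only [mul_expect, ← expect_add_distrib]
    exact expect_congr rfl fun a _ => expect_congr rfl fun b _ => by ring
  have hrow : ∀ a, 𝔼 b, (f a b - c * sylvester d a b) * α a * β b =
      ((f a a - c * sylvester d a a) * α a * β a) / 2 ^ d := by
    intro a
    rw [Fintype.expect_eq_sum_div_card, sum_eq_single a (fun b _ hb => by simp [hoff a b hb.symm])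
      (by simp)]
    simp
  have hr : |𝔼 a, 𝔼 b, (f a b - c * sylvester d a b) * α a * β b| ≤ δ / 2 := by
    refine (abs_expect_le _ _).trans (expect_le univ_nonempty fun a _ => ?_)
    rw [hrow, abs_div, abs_mul, abs_mul, abs_of_pos (by positivity : (0 : ℝ) < 2 ^ d)]
    refine le_trans (div_le_div_of_nonneg_right ?_ (by positivity)) hd'
    exact mul_le_one₀ (mul_le_one₀ (hdiag a) (abs_nonneg _) (hα a)) (abs_nonneg _) (hβ a)
  have hm := cutNormLE_sylvester hδ hd α β hα hβ
  rw [hsplit]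
  refine (abs_add_le _ _).trans ?_
  rw [abs_mul]
  have := mul_le_mul hc hm (abs_nonneg _) (by norm_num)
  linarith

/-- The adjacency indicator of a graph, as a real-valued function. -/
noncomputable def adjInd {V : Type*} (G : SimpleGraph V) (a b : V) : ℝ :=
  open Classical in if G.Adj a b then 1 else 0

theorem adjInd_nonneg {V : Type*} (G : SimpleGraph V) (a b : V) : 0 ≤ adjInd G a b := by
  unfold adjInd; split_ifs <;> norm_num

theorem adjInd_le_one {V : Type*} (G : SimpleGraph V) (a b : V) : adjInd G a b ≤ 1 := by
  unfold adjInd; split_ifs <;> norm_num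

theorem abs_adjInd_le_one {V : Type*} (G : SimpleGraph V) (a b : V) : |adjInd G a b| ≤ 1 :=
  abs_le.2 ⟨by linarith [adjInd_nonneg G a b], adjInd_le_one G a b⟩

/-- There are graphs of density about `1 / 2` with arbitrarily good quasirandomness. The
complement is included because the diagonal, though negligible, is in neither graph. -/
theorem exists_quasirandom {δ : ℝ} (hδ : 0 < δ) :
    ∃ (V : Type) (_ : Fintype V) (_ : Nonempty V) (H : SimpleGraph V),
      CutNormLE (fun a b => adjInd H a b - 1 / 2) δ ∧
        CutNormLE (fun a b => adjInd Hᶜ a b - 1 / 2) δ := by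
  obtain ⟨d, hd⟩ := exists_pow_lt_of_lt_one (lt_min (pow_pos hδ 2) (half_pos hδ))
    (by norm_num : (1 / 2 : ℝ) < 1)
  rw [one_div_pow, lt_min_iff] at hd
  let H : SimpleGraph (Fin d → Bool) :=
    { Adj := fun a b => a ≠ b ∧ sylvester d a b = -1
      symm := ⟨fun a b h => ⟨h.1.symm, by rw [sylvester_comm]; exact h.2⟩⟩
      loopless := ⟨fun a h => h.1 rfl⟩ }
  refine ⟨Fin d → Bool, inferInstance, inferInstance, H,
    .of_sylvester (c := -1 / 2) hδ.le hd.1.le hd.2.le (by norm_num [abs_le]) (fun a => ?_)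
      fun a b hab => ?_,
    .of_sylvester (c := 1 / 2) hδ.le hd.1.le hd.2.le (by norm_num [abs_le]) (fun a => ?_)
      fun a b hab => ?_⟩
  · rcases sylvester_eq_or d a a with h | h <;> norm_num [adjInd, h, abs_le]
  · rcases sylvester_eq_or d a b with h | h <;> norm_num [adjInd, h, H, hab]
  · rcases sylvester_eq_or d a a with h | h <;> norm_num [adjInd, h, abs_le]
  · rcases sylvester_eq_or d a b with h | h <;> norm_num [adjInd, h, H, hab]

/-! ### Dense subgraphs of quasirandom graphs contain many cliques -/

/-- The pairs `(i, j)` with `i < j`, representing the two-element subsets of `Fin m`. -/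
def increasingPairs (m : ℕ) : Finset (Fin m × Fin m) := univ.filter fun p => p.1 < p.2

theorem mem_increasingPairs {m : ℕ} {p : Fin m × Fin m} : p ∈ increasingPairs m ↔ p.1 < p.2 := by
  simp [increasingPairs]

theorem ne_and_swap_notMem {m : ℕ} (p : Fin m × Fin m) (hp : p ∈ increasingPairs m) :
    p.1 ≠ p.2 ∧ p.swap ∉ increasingPairs m := by
  simp only [mem_increasingPairs, Prod.fst_swap, Prod.snd_swap] at *
  exact ⟨hp.ne, hp.asymm⟩

theorem forall_increasingPairs_adj_iff {m : ℕ} {V : Type*} {G : SimpleGraph V} {y : Fin m → V} :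
    (∀ p ∈ increasingPairs m, G.Adj (y p.1) (y p.2)) ↔ ∀ i j, i ≠ j → G.Adj (y i) (y j) := by
  refine ⟨fun h i j hij => ?_, fun h p hp => h _ _ (ne_and_swap_notMem p hp).1⟩
  rcases hij.lt_or_gt with hij | hij
  · exact h (i, j) (mem_increasingPairs.2 hij)
  · exact (h (j, i) (mem_increasingPairs.2 hij)).symm

theorem prod_adjInd_eq_one {ι V : Type*} {G : SimpleGraph V} {T : Finset (ι × ι)} {x : ι → V}
    (h : ∀ p ∈ T, G.Adj (x p.1) (x p.2)) : ∏ p ∈ T, adjInd G (x p.1) (x p.2) = 1 :=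
  prod_eq_one fun p hp => by simp [adjInd, h p hp]

theorem sum_increasingPairs_adjInd {m : ℕ} (G : SimpleGraph (Fin m)) :
    ∑ p ∈ increasingPairs m, adjInd G p.1 p.2 = G.edgeSet.ncard := by
  classical
  simp only [adjInd, sum_boole]
  rw [← SimpleGraph.coe_edgeFinset, Set.ncard_coe_finset]
  norm_cast
  refine card_bij (fun p _ => s(p.1, p.2)) ?_ ?_ ?_
  · intro p hp
    simpa using (mem_filter.1 hp).2
  · rintro ⟨a, b⟩ h ⟨a', b'⟩ h' he
    have h1 := mem_increasingPairs.1 (mem_filter.1 h).1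
    have h2 := mem_increasingPairs.1 (mem_filter.1 h').1
    rcases Sym2.eq_iff.1 he with ⟨rfl, rfl⟩ | ⟨rfl, rfl⟩
    · rfl
    · exact absurd h1 h2.asymm
  · intro e
    induction e with | _ a b
    intro he
    have hab : G.Adj a b := by simpa using he
    rcases hab.ne.lt_or_gt with h | h
    · exact ⟨(a, b), by simp [mem_increasingPairs, h, hab], rfl⟩
    · exact ⟨(b, a), by simp [mem_increasingPairs, h, hab.symm], Sym2.eq_swap⟩

theorem expect_adjInd {V : Type*} [Fintype V] (G : SimpleGraph V) :
    𝔼 a, 𝔼 b, adjInd G a b = 2 * G.edgeSet.ncard / (Fintype.card V : ℝ) ^ 2 := by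
  classical
  have h : ∑ a, ∑ b, adjInd G a b = 2 * G.edgeSet.ncard := by
    rw [← SimpleGraph.coe_edgeFinset, Set.ncard_coe_finset]
    have := G.sum_degrees_eq_twice_card_edges
    rw [← Nat.cast_ofNat, ← Nat.cast_mul, ← this]
    push_cast
    refine sum_congr rfl fun a _ => ?_
    simp [adjInd, sum_boole, ← SimpleGraph.card_neighborFinset_eq_degree,
      SimpleGraph.neighborFinset_eq_filter]
  simp only [Fintype.expect_eq_sum_div_card, ← sum_div, div_div, ← sq, h]

theorem card_increasingPairs (m : ℕ) : (#(increasingPairs m) : ℝ) = m * (m - 1) / 2 := by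
  classical
  have h := sum_increasingPairs_adjInd (⊤ : SimpleGraph (Fin m))
  rw [← SimpleGraph.coe_edgeFinset, Set.ncard_coe_finset,
    SimpleGraph.card_edgeFinset_top_eq_card_choose_two, Fintype.card_fin, Nat.cast_choose_two] at h
  rw [← h, card_eq_sum_ones]
  push_cast
  refine sum_congr rfl fun p hp => ?_
  simp [adjInd, (ne_and_swap_notMem p hp).1]

/-- Turán's theorem, in its asymptotic form. -/
theorem exists_edge_density_le_of_cliqueFree {r : ℕ} (hr : 0 < r) {ε : ℝ} (hε : 0 < ε) :
    ∃ m : ℕ, 2 ≤ m ∧ ∀ G : SimpleGraph (Fin m), G.CliqueFree (r + 1) →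
      ∑ p ∈ increasingPairs m, adjInd G p.1 p.2 ≤ (1 - 1 / r + ε) * #(increasingPairs m) := by
  classical
  obtain ⟨m, hm⟩ := exists_nat_ge (2 + (1 + ε) / ε)
  have hm2 : (2 : ℝ) ≤ m := by linarith [show 0 ≤ (1 + ε) / ε by positivity]
  refine ⟨m, by exact_mod_cast hm2, fun G hG => ?_⟩
  have hr0 : (0 : ℝ) < r := by exact_mod_cast hr
  have hmax : #G.edgeFinset ≤ #(SimpleGraph.turanGraph m r).edgeFinset :=
    (SimpleGraph.isTuranMaximal_turanGraph hr).2 hG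
  have hT : (2 * r * #(SimpleGraph.turanGraph m r).edgeFinset : ℝ) ≤ (r - 1) * m ^ 2 := by
    have := SimpleGraph.mul_card_edgeFinset_turanGraph_le (n := m) (r := r)
    have h' : ((2 * r * #(SimpleGraph.turanGraph m r).edgeFinset : ℕ) : ℝ) ≤
      (((r - 1) * m ^ 2 : ℕ) : ℝ) := by exact_mod_cast this
    push_cast [Nat.cast_sub (show 1 ≤ r from hr)] at h'
    exact h'
  rw [sum_increasingPairs_adjInd, ← SimpleGraph.coe_edgeFinset, Set.ncard_coe_finset,
    card_increasingPairs]
  have h1 : (#G.edgeFinset : ℝ) ≤ (1 - 1 / r) * m ^ 2 / 2 := by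
    have : (#G.edgeFinset : ℝ) ≤ #(SimpleGraph.turanGraph m r).edgeFinset := by exact_mod_cast hmax
    refine this.trans ?_
    rw [show (1 - 1 / (r : ℝ)) * m ^ 2 / 2 = (r - 1) * m ^ 2 / (2 * r) by field_simp,
      le_div_iff₀ (by positivity)]
    linarith
  have h2 : 1 + ε ≤ m * ε := by
    have : (1 + ε) / ε ≤ m := by linarith
    rwa [div_le_iff₀ hε] at this
  have h3 : 0 < 1 / (r : ℝ) := by positivity
  have h4 : (1 - 1 / (r : ℝ)) * m ≤ (1 - 1 / r + ε) * (m - 1) := by nlinarith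
  nlinarith

/-- Averaging the number of edges of `S` over the `m`-cliques of `H`: by Turán's theorem, a
positive proportion of these cliques contain a `k`-clique of `S`. -/
theorem exists_clique_density {r : ℕ} (hr : 0 < r) {ε : ℝ} (hε : 0 < ε) :
    ∃ κ > (0 : ℝ), ∃ δ > (0 : ℝ), ∀ (V : Type) [Fintype V] [Nonempty V] (H S : SimpleGraph V),
      S ≤ H → CutNormLE (fun a b => adjInd H a b - 1 / 2) δ →
      (1 - 1 / r + ε) * (H.edgeSet.ncard : ℝ) ≤ S.edgeSet.ncard →
      κ ≤ 𝔼 y : Fin (r + 1) → V, ∏ p ∈ increasingPairs (r + 1), adjInd S (y p.1) (y p.2) := by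
  classical
  obtain ⟨m, hm2, hm⟩ := exists_edge_density_le_of_cliqueFree hr (half_pos hε)
  set T := increasingPairs m
  have hC : (0 : ℝ) < #T := by
    have : (2 : ℝ) ≤ m := by exact_mod_cast hm2
    rw [card_increasingPairs]
    nlinarith
  set C : ℝ := ((#T : ℕ) : ℝ) with hCdef
  set α : ℝ := 1 - 1 / r with hα
  have hα0 : 0 ≤ α := by
    have : 1 / (r : ℝ) ≤ 1 := by
      rw [div_le_one (by exact_mod_cast hr)]
      exact_mod_cast hr
    linarith
  set q : ℝ := (1 / 2) ^ #T with hq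
  have hq0 : 0 < q := by positivity
  -- The total coefficient of the error `δ` in the comparison of the two averages below.
  set D : ℝ := 2 * q * (α + ε) + C + (α + ε / 2) * C with hD
  have hD0 : 0 < D := by positivity
  set K : ℝ := ((Fintype.card (Fin (r + 1) ↪ Fin m) : ℕ) : ℝ) with hK
  have hK0 : 0 ≤ K := by positivity
  refine ⟨q * ε / 4 / (K + 1), by positivity, q * ε / 4 / D, by positivity, ?_⟩
  intro V _ _ H S hSH hcut hdense
  set δ : ℝ := q * ε / 4 / D with hδ
  have hδ0 : 0 < δ := by positivity
  set κ := 𝔼 y : Fin (r + 1) → V, ∏ p ∈ increasingPairs (r + 1), adjInd S (y p.1) (y p.2)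
  set σ := 𝔼 a, 𝔼 b, adjInd S a b with hσ
  set w : (Fin m → V) → ℝ := fun x => ∏ p ∈ T, adjInd H (x p.1) (x p.2) with hw
  have hw0 : ∀ x, 0 ≤ w x := fun x => prod_nonneg fun _ _ => adjInd_nonneg _ _ _
  have hw1 : ∀ x, w x ≤ 1 := fun x =>
    prod_le_one (fun _ _ => adjInd_nonneg _ _ _) fun _ _ => adjInd_le_one _ _ _
  have hσ1 : (α + ε) * (1 / 2 - δ) ≤ σ := by
    have hη : 1 / 2 - δ ≤ 𝔼 a, 𝔼 b, adjInd H a b := by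
      have h := hcut (fun _ => 1) (fun _ => 1) (by simp) (by simp)
      simp only [mul_one, expect_sub_distrib, Fintype.expect_const] at h
      linarith [(abs_le.1 h).1]
    refine (mul_le_mul_of_nonneg_left hη (by positivity)).trans ?_
    rw [hσ, expect_adjInd, expect_adjInd, mul_div_assoc', ← mul_assoc, mul_comm _ (2 : ℝ), mul_assoc]
    gcongr
  have hhalf : |(1 / 2 : ℝ)| ≤ 1 := by norm_num [abs_le]
  -- The proportion of `m`-tuples that are cliques of `H`.
  have hcliques : 𝔼 x, w x ≤ q + C * δ := by
    have h := counting_lemma (V := V) (T := T) ne_and_swap_notMem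
      (g := fun _ => adjInd H) (g' := fun _ _ _ => 1 / 2) (fun _ => abs_adjInd_le_one H)
      (fun _ _ _ => hhalf) fun _ _ => hcut
    simp only [prod_const, Fintype.expect_const] at h
    linarith [(abs_le.1 h).2]
  -- The proportion of `m`-tuples that are cliques of `H` and have an edge of `S` in position `p`.
  have hedge : ∀ p ∈ T, 2 * q * σ - C * δ ≤ 𝔼 x : Fin m → V, adjInd S (x p.1) (x p.2) * w x := by
    intro p hp
    have h := counting_lemma (V := V) (T := T) ne_and_swap_notMem
      (g := fun p' => if p' = p then adjInd S else adjInd H)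
      (g' := fun p' => if p' = p then adjInd S else fun _ _ => 1 / 2) (δ := δ)
      (fun p' a b => by split_ifs <;> exact abs_adjInd_le_one _ a b)
      (fun p' a b => by split_ifs; exacts [abs_adjInd_le_one _ a b, hhalf])
      (fun p' _ => by
        split_ifs
        · intro _ _ _ _
          simpa using hδ0.le
        · exact hcut)
    have e1 : ∀ x : Fin m → V, ∏ p' ∈ T, (if p' = p then adjInd S else adjInd H) (x p'.1) (x p'.2) =
        adjInd S (x p.1) (x p.2) * w x := by
      intro x
      simp only [hw]
      rw [← mul_prod_erase T _ hp, ← mul_prod_erase T _ hp, if_pos rfl, ← mul_assoc]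
      congr 1
      -- The factor of `H` at `p` is absorbed by that of `S`, as `S ≤ H`.
      · by_cases hs : S.Adj (x p.1) (x p.2)
        · simp [adjInd, hs, hSH hs]
        · simp [adjInd, hs]
      · exact prod_congr rfl fun p' hp' => by rw [if_neg (mem_erase.1 hp').1]
    have e2 : ∀ x : Fin m → V,
        ∏ p' ∈ T, (if p' = p then adjInd S else fun _ _ => 1 / 2) (x p'.1) (x p'.2) =
        adjInd S (x p.1) (x p.2) * (2 * q) := by
      intro x
      rw [← mul_prod_erase T _ hp, if_pos rfl]
      congr 1
      rw [prod_congr rfl fun p' hp' => by rw [if_neg (mem_erase.1 hp').1], prod_const, hq,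
        ← card_erase_add_one hp, pow_succ]
      ring
    simp only [e1, e2, ← expect_mul] at h
    rw [expect_pair (ne_and_swap_notMem p hp).1] at h
    linarith [(abs_le.1 h).1]
  -- Turán's theorem, applied to the graph that `S` induces on a single tuple.
  have hpoint : ∀ x : Fin m → V, (∑ p ∈ T, adjInd S (x p.1) (x p.2)) * w x ≤
      (α + ε / 2) * C * w x + C * ∑ φ : Fin (r + 1) ↪ Fin m,
        ∏ p ∈ increasingPairs (r + 1), adjInd S (x (φ p.1)) (x (φ p.2)) := by
    intro x
    have hQ : ∀ φ : Fin (r + 1) ↪ Fin m,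
        0 ≤ ∏ p ∈ increasingPairs (r + 1), adjInd S (x (φ p.1)) (x (φ p.2)) :=
      fun φ => prod_nonneg fun _ _ => adjInd_nonneg _ _ _
    by_cases hfree : (S.comap x).CliqueFree (r + 1)
    · have h := hm _ hfree
      have h' : ∑ p ∈ T, adjInd S (x p.1) (x p.2) ≤ (α + ε / 2) * C := h
      have := mul_le_mul_of_nonneg_right h' (hw0 x)
      have := mul_nonneg hC.le (sum_nonneg fun φ (_ : φ ∈ univ) => hQ φ)
      linarith
    · let φ := SimpleGraph.topEmbeddingOfNotCliqueFree hfree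
      have hφ : ∏ p ∈ increasingPairs (r + 1),
          adjInd S (x (φ.toEmbedding p.1)) (x (φ.toEmbedding p.2)) = 1 :=
        prod_adjInd_eq_one (x := fun i => x (φ i)) <| forall_increasingPairs_adj_iff.2
          fun i j hij => (φ.map_adj_iff (v := i) (w := j)).2 hij
      have h1 : 1 ≤ ∑ φ : Fin (r + 1) ↪ Fin m,
          ∏ p ∈ increasingPairs (r + 1), adjInd S (x (φ p.1)) (x (φ p.2)) :=
        hφ ▸ single_le_sum (fun φ _ => hQ φ) (mem_univ φ.toEmbedding)
      have h2 : ∑ p ∈ T, adjInd S (x p.1) (x p.2) ≤ C := by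
        rw [hCdef, ← nsmul_one, ← sum_const]
        exact sum_le_sum fun p _ => adjInd_le_one _ _ _
      have h3 := mul_le_mul h2 (hw1 x) (hw0 x) hC.le
      have h4 := mul_le_mul_of_nonneg_left h1 hC.le
      have h5 : 0 ≤ (α + ε / 2) * C * w x := mul_nonneg (by positivity) (hw0 x)
      linarith
  have hmain : C * (2 * q * σ - C * δ) ≤ (α + ε / 2) * C * (q + C * δ) + C * (K * κ) := by
    calc C * (2 * q * σ - C * δ) = ∑ p ∈ T, (2 * q * σ - C * δ) := by
          rw [sum_const, nsmul_eq_mul]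
      _ ≤ ∑ p ∈ T, 𝔼 x : Fin m → V, adjInd S (x p.1) (x p.2) * w x := sum_le_sum hedge
      _ = 𝔼 x : Fin m → V, (∑ p ∈ T, adjInd S (x p.1) (x p.2)) * w x := by
          rw [← expect_sum_comm]
          exact expect_congr rfl fun x _ => by rw [sum_mul]
      _ ≤ _ := expect_le_expect fun x _ => hpoint x
      _ = (α + ε / 2) * C * 𝔼 x, w x + C * (K * κ) := by
          rw [expect_add_distrib, ← mul_expect, ← mul_expect, expect_sum_comm]
          congr 3
          rw [hK, ← card_univ, ← nsmul_eq_mul, ← sum_const]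
          exact sum_congr rfl fun φ _ => expect_comp_injective φ.injective
            fun y => ∏ p ∈ increasingPairs (r + 1), adjInd S (y p.1) (y p.2)
      _ ≤ _ := by gcongr
  have hκ0 : 0 ≤ κ := expect_nonneg fun _ _ => prod_nonneg fun _ _ => adjInd_nonneg _ _ _
  have hfin : 2 * q * σ - C * δ ≤ (α + ε / 2) * (q + C * δ) + K * κ := by
    refine le_of_mul_le_mul_left ?_ hC
    linarith
  have hδD : δ * D = q * ε / 4 := by rw [hδ]; field_simp
  have h6 := mul_le_mul_of_nonneg_left hσ1 (by positivity : 0 ≤ 2 * q)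
  rw [div_le_iff₀ (by positivity)]
  rw [hD] at hδD
  nlinarith

/-! ### Induced copies of `k`-colourable graphs -/

/-- A graph containing many `k`-cliques contains many homomorphic images of every `k`-colourable
graph: the latter sits inside a blow-up of the `k`-clique. -/
theorem pow_clique_density_le {V : Type*} [Fintype V] [Nonempty V] (S : SimpleGraph V) {k t : ℕ}
    {L : SimpleGraph (Fin t)} (C : L.Coloring (Fin k)) :
    (𝔼 y : Fin k → V, ∏ p ∈ increasingPairs k, adjInd S (y p.1) (y p.2)) ^ t ^ k ≤
      𝔼 z : Fin t → V, ∏ p ∈ increasingPairs t,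
        open Classical in if L.Adj p.1 p.2 then adjInd S (z p.1) (z p.2) else 1 := by
  classical
  have hφ : Injective fun u : Fin t => (C u, u) := fun u v h => congrArg Prod.snd h
  rw [← expect_comp_injective hφ,
    ← Fintype.expect_equiv (Equiv.curry (Fin k) (Fin t) V).symm
      (fun x => ∏ p ∈ increasingPairs t,
        if L.Adj p.1 p.2 then adjInd S (x (C p.1) p.1) (x (C p.2) p.2) else 1) _ fun x => rfl]
  refine (pow_expect_le_expect_blowup t k _
    fun y => prod_nonneg fun _ _ => adjInd_nonneg _ _ _).trans (expect_le_expect fun x _ => ?_)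
  have hle : ∏ σ : Fin k → Fin t, ∏ p ∈ increasingPairs k,
      adjInd S (x p.1 (σ p.1)) (x p.2 (σ p.2)) ≤ 1 :=
    prod_le_one (fun _ _ => prod_nonneg fun _ _ => adjInd_nonneg _ _ _) fun _ _ =>
      prod_le_one (fun _ _ => adjInd_nonneg _ _ _) fun _ _ => adjInd_le_one _ _ _
  by_cases h : ∀ σ : Fin k → Fin t, ∀ p ∈ increasingPairs k,
      S.Adj (x p.1 (σ p.1)) (x p.2 (σ p.2))
  · refine hle.trans (le_of_eq (prod_eq_one fun p _ => ?_).symm)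
    by_cases hL : L.Adj p.1 p.2
    · rw [if_pos hL]
      -- Some transversal of the blow-up passes through both `p.1` and `p.2`.
      have hC : C p.1 ≠ C p.2 := C.valid hL
      have := (forall_increasingPairs_adj_iff
        (y := fun i => x i (if i = C p.1 then p.1 else p.2))).1 (h fun i =>
          if i = C p.1 then p.1 else p.2) _ _ hC
      rw [if_pos rfl, if_neg hC.symm] at this
      simp [adjInd, this]
    · rw [if_neg hL]
  · push Not at h
    obtain ⟨σ, p, hp, hS⟩ := h
    have h0 : ∏ p ∈ increasingPairs k, adjInd S (x p.1 (σ p.1)) (x p.2 (σ p.2)) = 0 :=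
      prod_eq_zero hp (by simp [adjInd, hS])
    refine (prod_eq_zero (mem_univ σ) h0).trans_le ?_
    refine prod_nonneg fun p _ => ?_
    by_cases hL : L.Adj p.1 p.2
    · simpa only [if_pos hL] using adjInd_nonneg _ _ _
    · simp only [if_neg hL, zero_le_one]

/-- For every `(r + 1)`-colourable graph `L` there is a graph `H` such that every subgraph `S` with
at least a `1 - 1 / r + ε` proportion of the edges contains a copy of `L` that is induced in `H`,
and hence also in `S`. -/
theorem exists_forall_dense_subgraph_exists_induced {r : ℕ} (hr : 0 < r) {ε : ℝ} (hε : 0 < ε)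
    {t : ℕ} {L : SimpleGraph (Fin t)} (C : L.Coloring (Fin (r + 1))) :
    ∃ (V : Type) (_ : Finite V) (H : SimpleGraph V), ∀ S ≤ H,
      (1 - 1 / r + ε) * (H.edgeSet.ncard : ℝ) ≤ S.edgeSet.ncard → Nonempty (L ↪g S) := by
  classical
  obtain ⟨κ, hκ, δ₀, hδ₀, hclique⟩ := exists_clique_density hr hε
  set T := increasingPairs t
  set c : ℝ := (1 / 2) ^ #T * κ ^ t ^ (r + 1) with hc
  have hc0 : 0 < c := by positivity
  have herr : ∀ a b : ℝ, |a - b| ≤ #T * (c / (#T + 1)) → c ≤ b → 0 < a := fun a b h h' => by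
    have : #T * (c / (#T + 1)) < c := by
      rw [mul_div_assoc', div_lt_iff₀ (by positivity)]
      linarith
    linarith [(abs_le.1 h).1]
  obtain ⟨V, _, _, H, hH, hH'⟩ := exists_quasirandom
    (lt_min hδ₀ (show 0 < c / (#T + 1) by positivity))
  refine ⟨V, inferInstance, H, fun S hSH hdense => ?_⟩
  have hκS := hclique V H S hSH (hH.mono (min_le_left _ _)) hdense
  have hhom := (pow_le_pow_left₀ hκ.le hκS _).trans (pow_clique_density_le S C)
  have hhalf : |(1 / 2 : ℝ)| ≤ 1 := by norm_num [abs_le]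
  have hcount := counting_lemma (V := V) (T := T) ne_and_swap_notMem
    (g := fun p => if L.Adj p.1 p.2 then adjInd S else adjInd Hᶜ)
    (g' := fun p => if L.Adj p.1 p.2 then adjInd S else fun _ _ => 1 / 2)
    (δ := c / (#T + 1))
    (fun p a b => by
      by_cases hL : L.Adj p.1 p.2
      · simpa only [if_pos hL] using abs_adjInd_le_one S a b
      · simpa only [if_neg hL] using abs_adjInd_le_one Hᶜ a b)
    (fun p a b => by
      by_cases hL : L.Adj p.1 p.2
      · simpa only [if_pos hL] using abs_adjInd_le_one S a b
      · simpa only [if_neg hL] using hhalf)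
    (fun p _ => by
      by_cases hL : L.Adj p.1 p.2
      · simp only [if_pos hL, sub_self]
        intro _ _ _ _
        simp only [zero_mul, expect_const_zero, abs_zero]
        positivity
      · simp only [if_neg hL]
        exact hH'.mono (min_le_right _ _))
  -- After the replacement, each non-edge of `L` contributes a factor `1 / 2`.
  have hmodel : c ≤ 𝔼 z : Fin t → V, ∏ p ∈ T,
      (if L.Adj p.1 p.2 then adjInd S else fun _ _ => 1 / 2) (z p.1) (z p.2) := by
    rw [hc]
    refine (mul_le_mul_of_nonneg_left hhom (by positivity)).trans ?_
    rw [mul_expect]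
    refine expect_le_expect fun z _ => ?_
    rw [← prod_const, ← prod_mul_distrib]
    refine prod_le_prod (fun p _ => ?_) fun p _ => ?_ <;> by_cases hL : L.Adj p.1 p.2 <;>
      simp only [if_pos, if_neg, hL, not_false_iff] <;>
      linarith [adjInd_nonneg S (z p.1) (z p.2)]
  have hpos : 0 < 𝔼 z : Fin t → V, ∏ p ∈ T,
      (if L.Adj p.1 p.2 then adjInd S else adjInd Hᶜ) (z p.1) (z p.2) :=
    herr _ _ hcount hmodel
  obtain ⟨z, -, hz⟩ := exists_ne_zero_of_expect_ne_zero hpos.ne'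
  rw [prod_ne_zero_iff] at hz
  have hz' : ∀ u v, u ≠ v → if L.Adj u v then S.Adj (z u) (z v) else Hᶜ.Adj (z u) (z v) := by
    have key : ∀ u v, u < v → if L.Adj u v then S.Adj (z u) (z v) else Hᶜ.Adj (z u) (z v) := by
      intro u v huv
      have h := hz (u, v) (mem_increasingPairs.2 huv)
      by_cases hL : L.Adj u v
      · simp only [if_pos hL] at h ⊢
        by_contra hn
        simp [adjInd, hn] at h
      · simp only [if_neg hL] at h ⊢
        by_contra hn
        simp [adjInd, hn] at h
    intro u v huv
    rcases huv.lt_or_gt with h | h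
    · exact key u v h
    · have := key v u h
      rw [SimpleGraph.adj_comm L, SimpleGraph.adj_comm S, SimpleGraph.adj_comm Hᶜ]
      exact this
  refine ⟨⟨⟨z, fun u v huv => ?_⟩, fun {u v} => ?_⟩⟩
  · by_contra hne
    have h := hz' u v hne
    by_cases hL : L.Adj u v
    · rw [if_pos hL] at h
      exact h.ne huv
    · rw [if_neg hL] at h
      exact h.ne huv
  · change S.Adj (z u) (z v) ↔ L.Adj u v
    by_cases huv : u = v
    · subst huv
      simp
    · have h := hz' u v huv
      by_cases hL : L.Adj u v
      · rw [if_pos hL] at h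
        exact iff_of_true h hL
      · rw [if_neg hL] at h
        exact iff_of_false (fun hS => ((SimpleGraph.compl_adj _ _ _).1 h).2 (hSH hS)) hL

/-! ### Hereditary properties -/

/-- The corona of `L`: a pendant edge is attached to each vertex. -/
def corona {W : Type*} (L : SimpleGraph W) : SimpleGraph (W × Bool) where
  Adj a b := (a.2 = false ∧ b.2 = false ∧ L.Adj a.1 b.1) ∨ (a.1 = b.1 ∧ a.2 ≠ b.2)
  symm := ⟨by
    rintro a b (⟨h1, h2, h3⟩ | ⟨h1, h2⟩)
    exacts [Or.inl ⟨h2, h1, h3.symm⟩, Or.inr ⟨h1.symm, h2.symm⟩]⟩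
  loopless := ⟨by rintro a (⟨-, -, h⟩ | ⟨-, h⟩); exacts [h.ne rfl, h rfl]⟩

theorem corona_colorable {W : Type*} {L : SimpleGraph W} {r : ℕ} (hr : 0 < r)
    (hL : L.Colorable (r + 1)) : (corona L).Colorable (r + 1) := by
  obtain ⟨C⟩ := hL
  have : Nontrivial (Fin (r + 1)) := Fin.nontrivial_iff_two_le.2 (by omega)
  choose f hf using fun i : Fin (r + 1) => exists_ne i
  refine ⟨SimpleGraph.Coloring.mk (fun a => if a.2 then f (C a.1) else C a.1) ?_⟩
  rintro ⟨u, a⟩ ⟨v, b⟩ (⟨h1, h2, h3⟩ | ⟨h1, h2⟩)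
  · simp only at h1 h2 h3
    subst h1 h2
    simpa using C.valid h3
  · simp only at h1 h2
    subst h1
    cases a <;> cases b <;> simp_all [(hf _).symm]

/-- Passing to the corona makes every vertex incident with an edge, so that an induced copy in the
spanning graph of a subgraph `S` only uses vertices of `S`. -/
theorem nonempty_embedding_coe_of_corona {V W : Type*} {H : SimpleGraph V} {L : SimpleGraph W}
    {S : H.Subgraph} (f : corona L ↪g S.spanningCoe) : Nonempty (L ↪g S.coe) := by
  have hmem : ∀ u, f (u, false) ∈ S.verts := fun u => by
    have h : S.spanningCoe.Adj (f (u, false)) (f (u, true)) :=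
      f.map_adj_iff.2 (Or.inr ⟨rfl, by simp⟩)
    exact S.edge_vert h
  refine ⟨⟨⟨fun u => ⟨f (u, false), hmem u⟩, fun u v h => ?_⟩, fun {u v} => ?_⟩⟩
  · exact congrArg Prod.fst (f.injective (congrArg Subtype.val h))
  · refine (f.map_adj_iff (v := (u, false)) (w := (v, false))).trans ?_
    simp [corona]

theorem GraphProperty.IsHereditary.of_embedding {P : GraphProperty} (hP : P.IsHereditary)
    {V W : Type} [Finite V] [Finite W] {G : SimpleGraph V} {L : SimpleGraph W} (f : L ↪g G)
    (hG : P V G) : P W L :=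
  hP.iso _ _ _ _ ⟨f.isoInduceRange.symm⟩ (hP.induce V G _ hG)

theorem corollary2p4 (P : GraphProperty) (hP : P.IsHereditary) (hP' : P.IsNontrivial)
    (ε : ℝ) (hε : 0 < ε) :
    ∃ (V : Type) (_ : Finite V) (H : SimpleGraph V),
      (GraphProperty.ex H P : ℝ) <
        (1 - 1 / ((P.minChromaticNumber : ℝ) - 1) + ε) * (H.edgeSet.ncard : ℝ) := by
  obtain ⟨W, _, L, hL, hχ⟩ := hP'.isLeast_minChromaticNumber.1
  obtain ⟨r, hrk⟩ : ∃ r, P.minChromaticNumber = r + 1 :=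
    ⟨P.minChromaticNumber - 1, by have := hP'.two_le_minChromaticNumber; omega⟩
  have hr : 0 < r := by have := hP'.two_le_minChromaticNumber; omega
  have := Fintype.ofFinite W
  have hcol : (corona L).Colorable (r + 1) :=
    corona_colorable hr (SimpleGraph.chromaticNumber_le_iff_colorable.1 (by rw [hχ, hrk]))
  let e := (corona L).overFinIso rfl
  obtain ⟨C⟩ : ((corona L).overFin rfl).Colorable (r + 1) := hcol.of_hom e.symm.toHom
  obtain ⟨V, _, H, hH⟩ := exists_forall_dense_subgraph_exists_induced hr hε C
  refine ⟨V, inferInstance, H, ?_⟩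
  by_contra! hle
  obtain ⟨S, hS, hcard⟩ := (hP'.isGreatest_ex H).1
  rw [hrk, ← hcard, ← S.edgeSet_spanningCoe] at hle
  push_cast at hle
  rw [add_sub_cancel_right] at hle
  obtain ⟨f⟩ := hH _ S.spanningCoe_le hle
  obtain ⟨g⟩ := nonempty_embedding_coe_of_corona (e.toEmbedding.trans f)
  exact hL (hP.of_embedding g hS)
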